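/- Conventions. A Krull domain is a domain $A$ that equals $\bigcap_{\mathfrak p}A_{\mathfrak p}$ ($\mathfrak p$ running over the primes of height $1$), such that every such $A_{\mathfrak p}$ is a discrete valuation ring and every nonzero element of $A$ lies in only finitely many primes of height $1$. Let $A$ be a noetherian Krull domain. A finitely generated torsion $A$-module is pseudo-null if its annihilator has height at least $2$; a homomorphism is a pseudo-isomorphism if its kernel and cokernel are pseudo-null. For a finitely generated $A$-module $M$ the characteristic ideal $Ch_A(M)$ is $0$ if $M$ is not torsion; if $M$ is torsion and $M\to\bigoplus_{i=1}^n A/\mathfrak p_i^{e_i}$ is a pseudo-isomorphism, with $\mathfrak p_i$ primes of height $1$, then $Ch_A(M)$ is the product of the $\mathfrak p_i^{e_i}$ in the group of divisors of $A$, i.e. the divisorial ideal $\bigcap_{\mathfrak p}\big(A\cap \prod_i\mathfrak p_i^{e_i}A_{\mathfrak p}\big)$, $\mathfrak p$ running over the primes of height $1$ (this is the ordinary product $\prod_i \mathfrak p_i^{e_i}$ if $A$ is a unique factorization domain). Theorem. Let $(\Lambda_d)_{d\ge 0}$ be an inverse system of noetherian Krull domains with surjective transition maps $\pi^{d+1}_{d}\colon\Lambda_{d+1}\to\Lambda_d$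 whose kernel $\mathfrak p_{d+1}=(t_{d+1})$ is a principal prime ideal of height $1$, and suppose that $\Lambda_{d+1}\simeq\varprojlim_n\Lambda_{d+1}/\mathfrak p_{d+1}^n$, for all $d\ge 0$. Let $\Lambda=\varprojlim_d\Lambda_d$ with projections $\pi_d\colon\Lambda\to\Lambda_d$. Let $(M_d)_{d\ge0}$ be an inverse system of finitely generated $\Lambda_d$-modules, with transition maps semilinear over the $\pi^{d+1}_d$, such that the $\Lambda$-module $M=\varprojlim_d M_d$ is finitely generated. Suppose that there is $d_0$ such that for all $d>d_0$: 1. the $\mathfrak p_d$-torsion submodule $(M_d)_{t_d}=\{m\in M_d: t_dm=0\}$ is a pseudo-null $\Lambda_{d-1}$-module; 2. $Ch_{\Lambda_{d-1}}(M_d/t_dM_d)\subseteq Ch_{\Lambda_{d-1}}(M_{d-1})$. Then $\pi^{d}_{d-1}\big(Ch_{\Lambda_d}(M_d)\big)\subseteq Ch_{\Lambda_{d-1}}(M_{d-1})$ for all $d>d_0$, so that the ideals $Ch_{\Lambda_d}(M_d)$, $d\ge d_0$, form an inverse system, and their preimages $\pi_d^{-1}(Ch_{\Lambda_d}(M_d))$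 a decreasing sequence of ideals of $\Lambda$. Consequently the pro-characteristic ideal $$\widetilde{Ch}_\Lambda(M):=\varprojlim_{d\ge d_0}\pi_d^{-1}\big(Ch_{\Lambda_d}(M_d)\big)=\bigcap_{d\ge d_0}\pi_d^{-1}\big(Ch_{\Lambda_d}(M_d)\big)$$ is well defined: it is the inverse limit of the ideals $\pi_d^{-1}(Ch_{\Lambda_d}(M_d))$ under the inclusions, it is identified through the maps $\pi_d$ with $\varprojlim_{d\ge d_0}Ch_{\Lambda_d}(M_d)$, and it does not change if $d_0$ is replaced by any $d_1\ge d_0$. -/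

import Mathlib

open scoped DirectSum

universe u v w

/-- The prime ideals of height one of a commutative ring. -/
abbrev HeightOnePrime (A : Type u) [CommRing A] : Type u :=
  {p : PrimeSpectrum A // p.asIdeal.height = 1}

/-- A domain `A` is a Krull domain if `A` is the intersection (in its fraction field) of its
localizations at primes of height one, all these localizations are discrete valuation rings, and
every nonzero element lies in only finitely many primes of height one. -/
structure IsKrullDomain (A : Type u) [CommRing A] [IsDomain A] : Prop where
  eq_inter : ∀ x : FractionRing A,
    (∀ p : HeightOnePrime A, ∃ a s : A, s ∉ p.1.asIdeal ∧
      x * algebraMap A (FractionRing A) s = algebraMap A (FractionRing A) a) →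
    ∃ a : A, algebraMap A (FractionRing A) a = x
  isDVR : ∀ p : HeightOnePrime A, IsDiscreteValuationRing (Localization.AtPrime p.1.asIdeal)
  finite_character : ∀ x : A, x ≠ 0 → {p : HeightOnePrime A | x ∈ p.1.asIdeal}.Finite

/-- A module is pseudo-null if it is finitely generated and torsion, and its annihilator has height
at least two (the unit ideal has height `⊤`, so the zero module is pseudo-null). -/
def IsPseudoNull (A : Type u) [CommRing A] (M : Type v) [AddCommGroup M] [Module A M] : Prop :=
  Module.Finite A M ∧ Module.IsTorsion A M ∧ 2 ≤ (Module.annihilator A M).height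

/-- A linear map is a pseudo-isomorphism if its kernel and its cokernel are pseudo-null. -/
def IsPseudoIso {A : Type u} [CommRing A] {M : Type v} {N : Type w} [AddCommGroup M] [Module A M]
    [AddCommGroup N] [Module A N] (f : M →ₗ[A] N) : Prop :=
  IsPseudoNull A (LinearMap.ker f) ∧ IsPseudoNull A (N ⧸ LinearMap.range f)

/-- The divisorial hull `⋂ₚ (I A_p ∩ A)` of an ideal `I` of a Krull domain, where `p` runs through
the primes of height one. If `I = ∏ pᵢ ^ eᵢ`, this is the divisorial ideal attached to the divisor
`∑ eᵢ pᵢ`, that is, the product of the `pᵢ ^ eᵢ` in the group of divisors. It is `I` itself when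
`I` is principal, in particular for all such products over a unique factorization domain. -/
def divisorialHull {A : Type u} [CommRing A] (I : Ideal A) : Ideal A :=
  ⨅ p : HeightOnePrime A,
    (I.map (algebraMap A (Localization.AtPrime p.1.asIdeal))).comap
      (algebraMap A (Localization.AtPrime p.1.asIdeal))

/-- `I` is a characteristic ideal of `M`: either `M` is not torsion and `I = 0`, or `M` is torsion,
`M` is pseudo-isomorphic to an elementary module `⨁ᵢ A ⧸ pᵢ ^ eᵢ` with primes `pᵢ` of height one, and
`I` is the (divisorial) product of the `pᵢ ^ eᵢ`. -/
def IsCharIdeal (A : Type u) [CommRing A] (M : Type v) [AddCommGroup M] [Module A M]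
    (I : Ideal A) : Prop :=
  (¬ Module.IsTorsion A M ∧ I = ⊥) ∨
  (Module.IsTorsion A M ∧
    ∃ (n : ℕ) (p : Fin n → HeightOnePrime A) (e : Fin n → ℕ)
      (f : M →ₗ[A] ⨁ i : Fin n, A ⧸ (p i).1.asIdeal ^ e i),
      IsPseudoIso f ∧ I = divisorialHull (∏ i, (p i).1.asIdeal ^ e i))

open Classical in
/-- The characteristic ideal of a module. For a finitely generated module over a noetherian Krull
domain there is exactly one `I` with `IsCharIdeal A M I`, and this is it. -/
noncomputable def charIdeal (A : Type u) [CommRing A] (M : Type v) [AddCommGroup M] [Module A M] :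
    Ideal A :=
  if h : ∃ I : Ideal A, IsCharIdeal A M I then h.choose else ⊥

section Descent

variable {R : Type u} {S : Type v} [CommRing R] [CommRing S] (φ : R →+* S)
  (hφ : Function.Surjective φ) (M : Type w) [AddCommGroup M] [Module R M]

/-- For `φ : R → S` surjective with kernel `𝔭`, so that `S ≅ R ⧸ 𝔭`: the `S`-module structure on the
`𝔭`-torsion submodule `{m | 𝔭 m = 0}` of an `R`-module `M`. -/
@[reducible]
noncomputable def torsionDescent : Module S (Submodule.torsionBySet R M (RingHom.ker φ)) :=
  Module.compHom _ (RingHom.quotientKerEquivOfSurjective hφ).symm.toRingHom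

/-- For `φ : R → S` surjective with kernel `𝔭`, so that `S ≅ R ⧸ 𝔭`: the `S`-module structure on the
quotient `M ⧸ 𝔭 M` of an `R`-module `M`. -/
@[reducible]
noncomputable def quotientDescent : Module S (M ⧸ RingHom.ker φ • (⊤ : Submodule R M)) :=
  Module.compHom _ (RingHom.quotientKerEquivOfSurjective hφ).symm.toRingHom

theorem torsionDescent_smul (r : R) (m : Submodule.torsionBySet R M (RingHom.ker φ)) :
    letI := torsionDescent φ hφ M
    φ r • m = r • m := by
  change ((RingHom.quotientKerEquivOfSurjective hφ).symm (φ r)) • m = r • m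
  have h : (RingHom.quotientKerEquivOfSurjective hφ).symm (φ r) =
      Ideal.Quotient.mk (RingHom.ker φ) r := by
    rw [RingEquiv.symm_apply_eq]; rfl
  rw [h, Submodule.torsionBySet.mk_smul]

theorem quotientDescent_smul (r : R) (m : M ⧸ RingHom.ker φ • (⊤ : Submodule R M)) :
    letI := quotientDescent φ hφ M
    φ r • m = r • m := by
  change ((RingHom.quotientKerEquivOfSurjective hφ).symm (φ r)) • m = r • m
  have h : (RingHom.quotientKerEquivOfSurjective hφ).symm (φ r) =
      Ideal.Quotient.mk (RingHom.ker φ) r := by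
    rw [RingEquiv.symm_apply_eq]; rfl
  rw [h]
  rfl

/-- The `𝔭`-torsion submodule of `M` is a pseudo-null module over `S ≅ R ⧸ 𝔭`. -/
def IsPseudoNullTorsion : Prop :=
  @IsPseudoNull S _ (Submodule.torsionBySet R M (RingHom.ker φ)) _ (torsionDescent φ hφ M)

/-- The characteristic ideal of `M ⧸ 𝔭 M` over `S ≅ R ⧸ 𝔭`. -/
noncomputable def charIdealQuotient : Ideal S :=
  @charIdeal S _ (M ⧸ RingHom.ker φ • (⊤ : Submodule R M)) _ (quotientDescent φ hφ M)

end Descent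

/-- `L`, with the projections `p d : L → X d`, is the inverse limit of the sequence
`⋯ → X 2 → X 1 → X 0` with transition maps `f`. -/
def IsInverseLimit {X : ℕ → Type u} (f : ∀ d, X (d + 1) → X d) {L : Type v}
    (p : ∀ d, L → X d) : Prop :=
  (∀ d l, f d (p (d + 1) l) = p d l) ∧
  ∀ x : ∀ d, X d, (∀ d, f d (x (d + 1)) = x d) → ∃! l, ∀ d, p d l = x d

/-- The preimage `π_d⁻¹(Ch(M_d))` in `L` of the characteristic ideal of `M_d`. -/
noncomputable def charPreimage {L : Type w} [CommRing L] {Λ : ℕ → Type u} [∀ d, CommRing (Λ d)]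
    (π : ∀ d, L →+* Λ d) (M : ℕ → Type v) [∀ d, AddCommGroup (M d)] [∀ d, Module (Λ d) (M d)]
    (d : ℕ) : Ideal L :=
  (charIdeal (Λ d) (M d)).comap (π d)

/-- The pro-characteristic ideal, computed from the levels `d ≥ d₀`: the intersection in `L` of the
ideals `π_d⁻¹(Ch(M_d))`. -/
noncomputable def proCharIdeal {L : Type w} [CommRing L] {Λ : ℕ → Type u} [∀ d, CommRing (Λ d)]
    (π : ∀ d, L →+* Λ d) (M : ℕ → Type v) [∀ d, AddCommGroup (M d)] [∀ d, Module (Λ d) (M d)]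
    (d₀ : ℕ) : Ideal L :=
  ⨅ k : ℕ, charPreimage π M (d₀ + k)

theorem proCharIdeal_le {L : Type w} [CommRing L] {Λ : ℕ → Type u} [∀ d, CommRing (Λ d)]
    (π : ∀ d, L →+* Λ d) (M : ℕ → Type v) [∀ d, AddCommGroup (M d)] [∀ d, Module (Λ d) (M d)]
    (d₀ k : ℕ) : proCharIdeal π M d₀ ≤ charPreimage π M (d₀ + k) :=
  iInf_le _ k

/-!
For a torsion module `N`, the multiplicity of a height one prime `p` in `Ch(N)` is the length of
`N_p`, and this is the order of `det D` at `p` whenever `N_p` is presented by a square matrix `D`.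

Let `φ : A → B` be surjective with kernel `(t)`, and `q` a prime of height one of `B`. As `B_q` is a
discrete valuation ring, `N / t N` has a square presentation at `q`; since the `t`-torsion of `N`
vanishes at `P = φ⁻¹ q`, it lifts to a square presentation `D` of `N` at `P`, hence at every height
one prime `p ⊆ P`. If `x` lies in `Ch(N)`, then `det D` divides `x` at all these `p`, so it divides
`x` at `P` because `A_P` is the intersection of the corresponding `A_p`. Therefore
`det (φ D) = φ (det D)` divides `φ x` at `q`, that is, `φ x` lies in `Ch(N / t N)`.
-/

section Length

variable {R : Type*} [CommRing R] [IsDomain R]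

theorem ord_prod {ι : Type*} (s : Finset ι) {a : ι → R} (ha : ∀ i ∈ s, a i ≠ 0) :
    Ring.ord R (∏ i ∈ s, a i) = ∑ i ∈ s, Ring.ord R (a i) := by
  classical
  induction s using Finset.induction_on with
  | empty => simp
  | insert i s hi ih =>
    rw [Finset.forall_mem_insert] at ha
    rw [Finset.prod_insert hi, Finset.sum_insert hi,
      Ring.ord_mul' R (mem_nonZeroDivisors_of_ne_zero ha.1), ih ha.2]

section PrincipalIdealRing

variable [IsPrincipalIdealRing R] {ι M : Type*} [Fintype ι] [AddCommGroup M] [Module R M]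

open Submodule in
theorem associated_det_prod_smithNormalFormCoeffs (b : Module.Basis ι R M) {N : Submodule R M}
    (h : Module.finrank R N = Module.finrank R M) (e : M ≃ₗ[R] N) :
    Associated (LinearMap.det (N.subtype ∘ₗ e.toLinearMap))
      (∏ i, smithNormalFormCoeffs b h i) := by
  classical
  let b' := smithNormalFormTopBasis b h
  let e' : M ≃ₗ[R] N := b'.equiv (smithNormalFormBotBasis b h) (Equiv.refl ι)
  have hdiag : LinearMap.toMatrix b' b' (N.subtype ∘ₗ e'.toLinearMap) =
      Matrix.diagonal (smithNormalFormCoeffs b h) := by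
    ext i j
    have : e' (b' j) = smithNormalFormBotBasis b h j := b'.equiv_apply j _ _
    rw [LinearMap.toMatrix_apply, LinearMap.comp_apply, LinearEquiv.coe_coe, this,
      Submodule.subtype_apply, smithNormalFormBotBasis_def, map_smul, Module.Basis.repr_self]
    obtain rfl | hij := eq_or_ne i j
    · simp
    · simp [hij]
  have hdet : LinearMap.det (N.subtype ∘ₗ e'.toLinearMap) = ∏ i, smithNormalFormCoeffs b h i := by
    rw [← LinearMap.det_toMatrix b', hdiag, Matrix.det_diagonal]
  exact hdet ▸ LinearMap.associated_det_comp_equiv N.subtype e e'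

theorem length_quotient_range_eq_ord_det [Module.Finite R M] [Module.Free R M] {f : M →ₗ[R] M}
    (hf : Function.Injective f) :
    Module.length R (M ⧸ LinearMap.range f) = Ring.ord R (LinearMap.det f) := by
  let b := Module.Free.chooseBasis R M
  let e : M ≃ₗ[R] LinearMap.range f := LinearEquiv.ofInjective f hf
  have hrank := e.finrank_eq.symm
  have hdet : Associated (LinearMap.det f) (∏ i, Submodule.smithNormalFormCoeffs b hrank i) :=
    associated_det_prod_smithNormalFormCoeffs b hrank e
  rw [(Submodule.quotientEquivPiSpan _ b hrank).length_eq, Module.length_pi_of_fintype,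
    Ring.ord_eq_of_associated hdet,
    ord_prod _ fun i _ => Submodule.smithNormalFormCoeffs_ne_zero b hrank i]
  rfl

theorem length_quotient_span_row_eq_ord_det [DecidableEq ι] {D : Matrix ι ι R} (hD : D.det ≠ 0) :
    Module.length R ((ι → R) ⧸ Submodule.span R (Set.range D.row)) = Ring.ord R D.det := by
  have hinj : Function.Injective D.transpose.toLin' :=
    Matrix.mulVec_injective_of_det_ne_zero (D.det_transpose.symm ▸ hD)
  rw [← D.col_transpose, ← Matrix.range_toLin', length_quotient_range_eq_ord_det hinj,
    LinearMap.det_toLin', Matrix.det_transpose]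

end PrincipalIdealRing

theorem ord_le_ord_iff_dvd [IsDiscreteValuationRing R] {a b : R} :
    Ring.ord R a ≤ Ring.ord R b ↔ a ∣ b := by
  rw [Ring.ord_eq_addVal, Ring.ord_eq_addVal, IsDiscreteValuationRing.addVal_le_iff_dvd]

theorem length_pi_quotient_le_ord_iff [IsDiscreteValuationRing R] {ι : Type*} [Fintype ι]
    {J : ι → Ideal R} (hJ : ∀ i, J i ≠ ⊥) {x : R} :
    Module.length R (∀ i, R ⧸ J i) ≤ Ring.ord R x ↔ x ∈ ∏ i, J i := by
  choose a ha using fun i => (IsPrincipalIdealRing.principal (J i)).principal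
  obtain rfl : J = fun i => Ideal.span {a i} := funext ha
  have ha0 : ∀ i, a i ≠ 0 := fun i h => hJ i (by simp [h])
  have hlen : Module.length R (∀ i, R ⧸ Ideal.span {a i}) = Ring.ord R (∏ i, a i) := by
    rw [Module.length_pi_of_fintype, ord_prod _ fun i _ => ha0 i]
    rfl
  rw [hlen, ord_le_ord_iff_dvd, Ideal.prod_span_singleton, Ideal.mem_span_singleton]

end Length

section IsIsoAt

variable {A : Type*} [CommRing A] {M N P : Type*} [AddCommGroup M] [Module A M] [AddCommGroup N]
  [Module A N] [AddCommGroup P] [Module A P] {S T : Submonoid A}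

/-- The linear map `f` becomes an isomorphism after localization at `S`. This is spelled out in
terms of elements of the kernel and of the cokernel, so that no localized module needs to be
chosen. -/
structure IsIsoAt (S : Submonoid A) (f : M →ₗ[A] N) : Prop where
  exists_smul_eq_zero : ∀ m, f m = 0 → ∃ s : S, s • m = 0
  exists_map_eq_smul : ∀ y, ∃ s : S, ∃ m, f m = s • y

namespace IsIsoAt

theorem mono {f : M →ₗ[A] N} (hf : IsIsoAt S f) (h : S ≤ T) : IsIsoAt T f where
  exists_smul_eq_zero m hm :=
    (hf.exists_smul_eq_zero m hm).imp' (Submonoid.inclusion h) fun _ => id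
  exists_map_eq_smul y :=
    (hf.exists_map_eq_smul y).imp' (Submonoid.inclusion h) fun _ => id

theorem of_linearEquiv (S : Submonoid A) (e : M ≃ₗ[A] N) : IsIsoAt S e.toLinearMap where
  exists_smul_eq_zero m hm := ⟨1, by simpa using hm⟩
  exists_map_eq_smul y := ⟨1, e.symm y, by simp⟩

theorem of_isTorsion' (f : M →ₗ[A] N) (hM : Module.IsTorsion' M S) (hN : Module.IsTorsion' N S) :
    IsIsoAt S f where
  exists_smul_eq_zero _ _ := @hM _
  exists_map_eq_smul y := (@hN y).imp fun s hs => ⟨0, by rw [map_zero, hs]⟩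

theorem comp {g : N →ₗ[A] P} {f : M →ₗ[A] N} (hg : IsIsoAt S g) (hf : IsIsoAt S f) :
    IsIsoAt S (g ∘ₗ f) where
  exists_smul_eq_zero m hm := by
    obtain ⟨s, hs⟩ := hg.exists_smul_eq_zero (f m) hm
    obtain ⟨r, hr⟩ := hf.exists_smul_eq_zero (s • m) (by
      rw [Submonoid.smul_def, map_smul]; exact hs)
    exact ⟨r * s, by rw [mul_smul, hr]⟩
  exists_map_eq_smul y := by
    obtain ⟨s, n, hn⟩ := hg.exists_map_eq_smul y
    obtain ⟨r, m, hm⟩ := hf.exists_map_eq_smul n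
    exact ⟨r * s, m, by
      rw [LinearMap.comp_apply, hm, mul_smul, ← hn, Submonoid.smul_def, map_smul]; rfl⟩

theorem isTorsion {f : M →ₗ[A] N} (hf : IsIsoAt S f) (hS : S ≤ nonZeroDivisors A)
    (hN : Module.IsTorsion A N) : Module.IsTorsion A M := by
  intro m
  obtain ⟨a, ha⟩ := @hN (f m)
  obtain ⟨s, hs⟩ := hf.exists_smul_eq_zero (a • m) (by rw [Submonoid.smul_def, map_smul]; exact ha)
  exact ⟨Submonoid.inclusion hS s * a, by rw [mul_smul]; exact hs⟩

theorem isLocalizedModule_comp {f : M →ₗ[A] N} (hf : IsIsoAt S f) (l : N →ₗ[A] P)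
    [IsLocalizedModule S l] : IsLocalizedModule S (l ∘ₗ f) where
  map_units := IsLocalizedModule.map_units l
  surj y := by
    obtain ⟨⟨n, s⟩, hn⟩ := IsLocalizedModule.surj S l y
    obtain ⟨r, m, hm⟩ := hf.exists_map_eq_smul n
    refine ⟨(m, r * s), ?_⟩
    rw [mul_smul, hn, LinearMap.comp_apply, hm, Submonoid.smul_def, Submonoid.smul_def, map_smul]
  exists_of_eq {m m'} h := by
    obtain ⟨s, hs⟩ := IsLocalizedModule.exists_of_eq (S := S) (f := l) h
    obtain ⟨r, hr⟩ := hf.exists_smul_eq_zero (s • (m - m')) (by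
      simpa [Submonoid.smul_def, smul_sub, sub_eq_zero] using hs)
    exact ⟨r * s, by rwa [mul_smul, mul_smul, ← sub_eq_zero, ← smul_sub, ← smul_sub]⟩

theorem exists_of_equiv [Module.FinitePresentation A M] {M' N' : Type*} [AddCommGroup M']
    [Module A M'] [AddCommGroup N'] [Module A N'] (l : M →ₗ[A] M') [IsLocalizedModule S l]
    (l' : N →ₗ[A] N') [IsLocalizedModule S l'] (e : M' ≃ₗ[A] N') :
    ∃ f : M →ₗ[A] N, IsIsoAt S f := by
  obtain ⟨f, s, hf⟩ :=
    Module.FinitePresentation.exists_lift_of_isLocalizedModule S l' (e.toLinearMap ∘ₗ l)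
  have hf' : ∀ m, l' (f m) = e (l (s • m)) := fun m => by
    simpa [Submonoid.smul_def] using LinearMap.congr_fun hf m
  refine ⟨f, fun m hm => ?_, fun y => ?_⟩
  · have : l (s • m) = 0 := by
      rw [← e.map_eq_zero_iff, ← hf', hm, map_zero]
    obtain ⟨r, hr⟩ := (IsLocalizedModule.eq_zero_iff S l).mp this
    exact ⟨r * s, by rw [mul_smul, hr]⟩
  · obtain ⟨⟨m, r⟩, hm⟩ := IsLocalizedModule.surj S l (e.symm (l' y))
    have : l' (f m) = l' ((s * r) • y) := by
      rw [hf']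
      simp only [Submonoid.smul_def, map_smul, ← hm, mul_smul, LinearEquiv.apply_symm_apply]
    obtain ⟨c, hc⟩ := IsLocalizedModule.exists_of_eq (S := S) this
    refine ⟨c * (s * r), c • m, ?_⟩
    rw [mul_smul, ← hc]
    exact map_smul f (c : A) m

end IsIsoAt

theorem isTorsion'_pi {ι : Type*} [Finite ι] {E : ι → Type*} [∀ i, AddCommGroup (E i)]
    [∀ i, Module A (E i)] (hE : ∀ i, Module.IsTorsion' (E i) S) :
    Module.IsTorsion' (∀ i, E i) S := by
  classical
  have := Fintype.ofFinite ι
  intro y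
  choose s hs using fun i => @hE i (y i)
  refine ⟨∏ i, s i, funext fun i => ?_⟩
  rw [Pi.smul_apply, ← Finset.prod_erase_mul _ _ (Finset.mem_univ i), mul_smul, hs, smul_zero]
  rfl

theorem IsIsoAt.pi_of_isTorsion' {ι : Type*} [Finite ι] {E : ι → Type*} [∀ i, AddCommGroup (E i)]
    [∀ i, Module A (E i)] {f : ∀ i, M →ₗ[A] E i} {i₀ : ι} (hf : IsIsoAt S (f i₀))
    (hE : ∀ i ≠ i₀, Module.IsTorsion' (E i) S) : IsIsoAt S (LinearMap.pi f) where
  exists_smul_eq_zero m hm := hf.exists_smul_eq_zero m (congrFun hm i₀)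
  exists_map_eq_smul y := by
    obtain ⟨s, m, hm⟩ := hf.exists_map_eq_smul (y i₀)
    have htors : Module.IsTorsion' (∀ i : {i // i ≠ i₀}, E i) S := isTorsion'_pi fun i => hE i i.2
    obtain ⟨r, hr⟩ := @htors fun i => f i m - s • y i
    refine ⟨r * s, r • m, funext fun i => ?_⟩
    rw [LinearMap.pi_apply, Submonoid.smul_def, map_smul, ← Submonoid.smul_def, Pi.smul_apply,
      mul_smul]
    obtain rfl | hi := eq_or_ne i i₀
    · rw [hm]
    · rw [← sub_eq_zero, ← smul_sub]
      exact congrFun hr ⟨i, hi⟩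

end IsIsoAt

section LocalLength

variable {A : Type*} [CommRing A] {p : Ideal A} [p.IsPrime] {M N : Type*} [AddCommGroup M]
  [Module A M] [AddCommGroup N] [Module A N]

variable (p M) in
/-- The length of `M_p` over the local ring `A_p`. If `A_p` is a discrete valuation ring and `M` is
torsion, this is the multiplicity of `p` in the divisor of `M`. -/
noncomputable def localLength : ℕ∞ :=
  Module.length (Localization.AtPrime p) (LocalizedModule p.primeCompl M)

theorem localLength_eq_length {M' : Type*} [AddCommGroup M'] [Module A M']
    [Module (Localization.AtPrime p) M'] [IsScalarTower A (Localization.AtPrime p) M']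
    (l : M →ₗ[A] M') [IsLocalizedModule p.primeCompl l] :
    localLength p M = Module.length (Localization.AtPrime p) M' :=
  ((IsLocalizedModule.linearEquiv p.primeCompl (LocalizedModule.mkLinearMap p.primeCompl M)
    l).extendScalarsOfIsLocalization p.primeCompl _).length_eq

theorem IsIsoAt.localLength_eq {f : M →ₗ[A] N} (hf : IsIsoAt p.primeCompl f) :
    localLength p M = localLength p N :=
  have := hf.isLocalizedModule_comp (LocalizedModule.mkLinearMap p.primeCompl N)
  localLength_eq_length (LocalizedModule.mkLinearMap p.primeCompl N ∘ₗ f)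

variable [IsDomain A]

theorem injective_algebraMap_localizationAtPrime (p : Ideal A) [p.IsPrime] :
    Function.Injective (algebraMap A (Localization.AtPrime p)) :=
  IsLocalization.injective _ p.primeCompl_le_nonZeroDivisors

theorem localLength_pi_quotient_le_ord_iff [IsDiscreteValuationRing (Localization.AtPrime p)]
    {ι : Type*} [Fintype ι] {I : ι → Ideal A} (hI : ∀ i, I i ≠ ⊥) {x : A} :
    localLength p (∀ i, A ⧸ I i) ≤
        Ring.ord (Localization.AtPrime p) (algebraMap A (Localization.AtPrime p) x) ↔
      algebraMap A (Localization.AtPrime p) x ∈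
        (∏ i, I i).map (algebraMap A (Localization.AtPrime p)) := by
  let R := Localization.AtPrime p
  let J i := (I i).localized' R p.primeCompl (Algebra.linearMap A R)
  have hJ : ∀ i, J i = (I i).map (algebraMap A R) := fun i => Ideal.localized'_eq_map R _ (I i)
  have hJ0 : ∀ i, J i ≠ ⊥ := fun i => by
    rw [hJ, Ne, Ideal.map_eq_bot_iff_of_injective (injective_algebraMap_localizationAtPrime p)]
    exact hI i
  let l : (∀ i, A ⧸ I i) →ₗ[A] ∀ i, R ⧸ J i := LinearMap.pi fun i =>
    (I i).toLocalizedQuotient' R p.primeCompl (Algebra.linearMap A R) ∘ₗ LinearMap.proj i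
  have hprod : ∏ i, J i = (∏ i, I i).map (algebraMap A R) :=
    (Finset.prod_congr rfl fun i _ => hJ i).trans
      (map_prod (Ideal.mapHom (algebraMap A R)) I Finset.univ).symm
  rw [localLength_eq_length l, length_pi_quotient_le_ord_iff hJ0, hprod]

theorem localLength_quotient_span_row [IsPrincipalIdealRing (Localization.AtPrime p)]
    {ι : Type*} [Fintype ι] [DecidableEq ι] {D : Matrix ι ι A} (hD : D.det ≠ 0) :
    localLength p ((ι → A) ⧸ Submodule.span A (Set.range D.row)) =
      Ring.ord (Localization.AtPrime p) (algebraMap A (Localization.AtPrime p) D.det) := by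
  let R := Localization.AtPrime p
  let l : (ι → A) →ₗ[A] (ι → R) := LinearMap.pi fun i => Algebra.linearMap A R ∘ₗ LinearMap.proj i
  have hspan : (Submodule.span A (Set.range D.row)).localized' R p.primeCompl l =
      Submodule.span R (Set.range (D.map (algebraMap A R)).row) := by
    rw [Submodule.localized'_span, ← Set.range_comp]
    rfl
  have hdet : (D.map (algebraMap A R)).det = algebraMap A R D.det :=
    ((algebraMap A R).map_det D).symm
  have hdet0 : algebraMap A R D.det ≠ 0 := by
    simpa using (injective_algebraMap_localizationAtPrime p).ne hD
  rw [localLength_eq_length (Submodule.toLocalizedQuotient' R p.primeCompl l _), hspan,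
    length_quotient_span_row_eq_ord_det (hdet ▸ hdet0), hdet]

end LocalLength

section Torsion

variable {A : Type*} [CommRing A]

theorem isTorsion'_quotient {S : Submonoid A} {I : Ideal A} (h : ∃ s ∈ S, s ∈ I) :
    Module.IsTorsion' (A ⧸ I) S := by
  obtain ⟨s, hs, hsI⟩ := h
  intro y
  obtain ⟨y, rfl⟩ := Submodule.Quotient.mk_surjective _ y
  refine ⟨⟨s, hs⟩, ?_⟩
  rw [Submonoid.mk_smul, ← Submodule.Quotient.mk_smul, Submodule.Quotient.mk_eq_zero]
  exact I.mul_mem_right _ hsI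

theorem exists_ne_zero_forall_smul_eq_zero [IsDomain A] {M : Type*} [AddCommGroup M] [Module A M]
    [Module.Finite A M] (hM : Module.IsTorsion A M) : ∃ a : A, a ≠ 0 ∧ ∀ m : M, a • m = 0 := by
  obtain ⟨a, ha, ha'⟩ := Submodule.annihilator_top_inter_nonZeroDivisors hM
  exact ⟨a, nonZeroDivisors.ne_zero ha', fun m => Submodule.mem_annihilator.mp ha m trivial⟩

theorem isTorsion_localizedModule [IsDomain A] (p : Ideal A) [p.IsPrime] {M : Type*}
    [AddCommGroup M] [Module A M] (hM : Module.IsTorsion A M) :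
    Module.IsTorsion (Localization.AtPrime p) (LocalizedModule p.primeCompl M) := by
  intro z
  obtain ⟨⟨m, s⟩, rfl⟩ :=
    IsLocalizedModule.mk'_surjective p.primeCompl (LocalizedModule.mkLinearMap p.primeCompl M) z
  obtain ⟨a, ham⟩ := @hM m
  have ha : algebraMap A (Localization.AtPrime p) a ≠ 0 := by simp
  refine ⟨⟨_, mem_nonZeroDivisors_of_ne_zero ha⟩, ?_⟩
  rw [Submonoid.mk_smul, algebraMap_smul, Function.uncurry_apply_pair, ← IsLocalizedModule.mk'_smul,
    show (a : A) • m = 0 from ham, IsLocalizedModule.mk'_zero]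

end Torsion

section HeightOne

variable {A : Type u} [CommRing A]

theorem HeightOnePrime.not_le_of_ne {p q : HeightOnePrime A} (hpq : p ≠ q) :
    ¬ p.1.asIdeal ≤ q.1.asIdeal := by
  intro hle
  have : p.1.asIdeal.FiniteHeight := ⟨Or.inr (by simp [p.2])⟩
  exact hpq (Subtype.ext (PrimeSpectrum.ext (Ideal.eq_of_le_of_height_le _ hle (by rw [p.2, q.2]))))

theorem HeightOnePrime.isTorsion'_quotient_pow_of_ne {p q : HeightOnePrime A} (hpq : p ≠ q)
    (e : ℕ) : Module.IsTorsion' (A ⧸ p.1.asIdeal ^ e) q.1.asIdeal.primeCompl := by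
  obtain ⟨c, hcp, hcq⟩ := SetLike.not_le_iff_exists.mp (not_le_of_ne hpq)
  exact isTorsion'_quotient
    ⟨c ^ e, fun h => hcq (q.1.2.mem_of_pow_mem _ h), Ideal.pow_mem_pow hcp e⟩

variable [IsDomain A]

theorem HeightOnePrime.pow_ne_bot (p : HeightOnePrime A) (e : ℕ) : p.1.asIdeal ^ e ≠ ⊥ :=
  pow_ne_zero e (Ideal.ne_bot_of_height_eq_one p.2)

theorem HeightOnePrime.isTorsion_quotient_pow (p : HeightOnePrime A) (e : ℕ) :
    Module.IsTorsion A (A ⧸ p.1.asIdeal ^ e) := by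
  obtain ⟨a, ha, ha0⟩ := Submodule.exists_mem_ne_zero_of_ne_bot (p.pow_ne_bot e)
  exact isTorsion'_quotient ⟨a, mem_nonZeroDivisors_of_ne_zero ha0, ha⟩

end HeightOne

section PseudoNull

variable {A : Type*} [CommRing A] {M N : Type*} [AddCommGroup M] [Module A M] [AddCommGroup N]
  [Module A N]

theorem IsPseudoNull.exists_notMem_forall_smul_eq_zero (hM : IsPseudoNull A M) (p : Ideal A)
    (hp : p.height ≤ 1) : ∃ s ∉ p, ∀ m : M, s • m = 0 := by
  have hle : ¬ Module.annihilator A M ≤ p := fun hle =>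
    absurd (hM.2.2.trans ((Ideal.height_mono hle).trans hp)) (by norm_num)
  obtain ⟨s, hs, hsp⟩ := SetLike.not_le_iff_exists.mp hle
  exact ⟨s, hsp, Module.mem_annihilator.mp hs⟩

theorem IsPseudoIso.isIsoAt {f : M →ₗ[A] N} (hf : IsPseudoIso f) (p : HeightOnePrime A) :
    IsIsoAt p.1.asIdeal.primeCompl f where
  exists_smul_eq_zero m hm := by
    obtain ⟨s, hs, hs'⟩ := hf.1.exists_notMem_forall_smul_eq_zero p.1.asIdeal p.2.le
    exact ⟨⟨s, hs⟩, congrArg Subtype.val (hs' ⟨m, hm⟩)⟩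
  exists_map_eq_smul y := by
    obtain ⟨s, hs, hs'⟩ := hf.2.exists_notMem_forall_smul_eq_zero p.1.asIdeal p.2.le
    exact ⟨⟨s, hs⟩, (Submodule.Quotient.mk_eq_zero _).mp (hs' (Submodule.Quotient.mk y))⟩

variable [IsDomain A]

theorem isPseudoNull_of_isTorsion' [Module.Finite A M] (hM : Module.IsTorsion A M)
    (h : ∀ p : HeightOnePrime A, Module.IsTorsion' M p.1.asIdeal.primeCompl) :
    IsPseudoNull A M := by
  refine ⟨inferInstance, hM, ?_⟩
  rw [Ideal.height_eq_inf_minimalPrimes]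
  refine le_iInf₂ fun J hJ => ?_
  have := hJ.1.1
  have h0 : J.height ≠ 0 := by
    obtain ⟨a, ha, haM⟩ := exists_ne_zero_forall_smul_eq_zero hM
    rw [Ne, Ideal.height_eq_zero_iff_eq_bot]
    rintro rfl
    exact ha (hJ.1.2 (Module.mem_annihilator.mpr haM))
  have h1 : J.height ≠ 1 := fun h1 => by
    have hmem : (⟨J, this⟩ : PrimeSpectrum A) ∈ Module.support A M := by
      rw [Module.support_eq_zeroLocus]
      exact hJ.1.2
    refine Module.notMem_support_iff'.mpr (fun m => ?_) hmem
    obtain ⟨s, hs⟩ := @h ⟨⟨J, this⟩, h1⟩ m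
    exact ⟨s, s.2, hs⟩
  have h1' : 1 < J.height := lt_of_le_of_ne (Order.one_le_iff_ne_zero.mpr h0) h1.symm
  simpa [one_add_one_eq_two] using Order.add_one_le_of_lt h1'

theorem isPseudoIso_of_isIsoAt [IsNoetherianRing A] [Module.Finite A M] [Module.Finite A N]
    (hM : Module.IsTorsion A M) (hN : Module.IsTorsion A N) {f : M →ₗ[A] N}
    (hf : ∀ p : HeightOnePrime A, IsIsoAt p.1.asIdeal.primeCompl f) : IsPseudoIso f := by
  refine ⟨isPseudoNull_of_isTorsion' (fun m => ?_) fun p m => ?_,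
    isPseudoNull_of_isTorsion' (fun y => ?_) fun p y => ?_⟩
  · exact (@hM m).imp fun a ha => Subtype.ext ha
  · exact ((hf p).exists_smul_eq_zero m m.2).imp fun s hs => Subtype.ext hs
  · obtain ⟨y, rfl⟩ := Submodule.Quotient.mk_surjective _ y
    obtain ⟨a, ha⟩ := @hN y
    exact ⟨a, congrArg (Submodule.mkQ _) ha⟩
  · obtain ⟨y, rfl⟩ := Submodule.Quotient.mk_surjective _ y
    obtain ⟨s, hs⟩ := (hf p).exists_map_eq_smul y
    exact ⟨s, (Submodule.Quotient.mk_eq_zero _).mpr hs⟩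

end PseudoNull

section Structure

variable {A : Type u} [CommRing A] [IsDomain A] [IsNoetherianRing A] {M : Type v} [AddCommGroup M]
  [Module A M] [Module.Finite A M]

theorem IsKrullDomain.exists_isIsoAt_pi_quotient_pow (hA : IsKrullDomain A)
    (hM : Module.IsTorsion A M) (p : HeightOnePrime A) :
    ∃ (ι : Type u) (_ : Fintype ι) (e : ι → ℕ) (f : M →ₗ[A] ∀ i, A ⧸ p.1.asIdeal ^ e i),
      IsIsoAt p.1.asIdeal.primeCompl f := by
  classical
  let S := p.1.asIdeal.primeCompl
  let R := Localization.AtPrime p.1.asIdeal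
  have : IsDiscreteValuationRing R := hA.isDVR p
  obtain ⟨ι, _, ϖ, hϖ, e, ⟨E⟩⟩ :=
    Module.equiv_directSum_of_isTorsion (isTorsion_localizedModule p.1.asIdeal hM)
  have hloc : ∀ i, Submodule.span R {ϖ i ^ e i} =
      (p.1.asIdeal ^ e i).localized' R S (Algebra.linearMap A R) := fun i => by
    rw [Ideal.localized'_eq_map, Ideal.map_pow, Localization.AtPrime.map_eq_maximalIdeal,
      (hϖ i).maximalIdeal_eq, Ideal.span_singleton_pow]
  let E' : LocalizedModule S M ≃ₗ[R]
      (∀ i, R ⧸ (p.1.asIdeal ^ e i).localized' R S (Algebra.linearMap A R)) :=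
    E.trans ((DirectSum.linearEquivFunOnFintype R ι _).trans
      (LinearEquiv.piCongrRight fun i => Submodule.quotEquivOfEq _ _ (hloc i)))
  have : Module.FinitePresentation A M := Module.finitePresentation_of_finite A M
  exact ⟨ι, inferInstance, e, IsIsoAt.exists_of_equiv (LocalizedModule.mkLinearMap S M)
    (LinearMap.pi fun i => (p.1.asIdeal ^ e i).toLocalizedQuotient' R S (Algebra.linearMap A R) ∘ₗ
      LinearMap.proj i) (E'.restrictScalars A)⟩

theorem IsKrullDomain.exists_isIsoAt_pi_pi_quotient_pow (hA : IsKrullDomain A)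
    (hM : Module.IsTorsion A M) :
    ∃ (F : Finset (HeightOnePrime A)) (ι : F → Type u) (_ : ∀ p, Fintype (ι p))
      (e : ∀ p, ι p → ℕ) (f : M →ₗ[A] ∀ p, ∀ i : ι p, A ⧸ p.1.1.asIdeal ^ e p i),
      ∀ p : HeightOnePrime A, IsIsoAt p.1.asIdeal.primeCompl f := by
  obtain ⟨a, ha, haM⟩ := exists_ne_zero_forall_smul_eq_zero hM
  let F := (hA.finite_character a ha).toFinset
  choose ι hι e f hf using fun p : F => hA.exists_isIsoAt_pi_quotient_pow hM p.1
  have htors : ∀ (p : HeightOnePrime A) (q : F), q.1 ≠ p →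
      Module.IsTorsion' (∀ i, A ⧸ q.1.1.asIdeal ^ e q i) p.1.asIdeal.primeCompl :=
    fun p q hq => isTorsion'_pi fun i => HeightOnePrime.isTorsion'_quotient_pow_of_ne hq _
  refine ⟨F, ι, hι, e, LinearMap.pi f, fun p => ?_⟩
  by_cases hp : p ∈ F
  · exact (hf ⟨p, hp⟩).pi_of_isTorsion' fun q hq => htors p q fun h => hq (Subtype.ext h)
  · have hap : a ∉ p.1.asIdeal := fun h => hp (by simpa [F] using h)
    exact .of_isTorsion' _ (fun m => ⟨⟨a, hap⟩, haM m⟩)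
      (isTorsion'_pi fun q => htors p q fun h => hp (h ▸ q.2))

theorem IsKrullDomain.exists_isPseudoIso (hA : IsKrullDomain A) (hM : Module.IsTorsion A M) :
    ∃ (n : ℕ) (p : Fin n → HeightOnePrime A) (e : Fin n → ℕ)
      (f : M →ₗ[A] ⨁ i : Fin n, A ⧸ (p i).1.asIdeal ^ e i), IsPseudoIso f := by
  obtain ⟨F, ι, _, e, f, hf⟩ := hA.exists_isIsoAt_pi_pi_quotient_pow hM
  let r := (Fintype.equivFin (Σ p : F, ι p)).symm
  let E (x : Σ p : F, ι p) : Type u := A ⧸ x.1.1.1.asIdeal ^ e x.1 x.2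
  let Φ : (∀ p, ∀ i : ι p, A ⧸ p.1.1.asIdeal ^ e p i) ≃ₗ[A] ⨁ k, E (r k) :=
    (LinearEquiv.piCurry A fun p i => E ⟨p, i⟩).symm.trans
      ((LinearEquiv.piCongrLeft A E r).symm.trans (DirectSum.linearEquivFunOnFintype A _ _).symm)
  have htors : Module.IsTorsion A (⨁ k, E (r k)) :=
    (IsIsoAt.of_linearEquiv ⊥ (DirectSum.linearEquivFunOnFintype A _ _)).isTorsion bot_le
      (isTorsion'_pi fun k => HeightOnePrime.isTorsion_quotient_pow _ _)
  exact ⟨_, fun k => (r k).1.1, fun k => e (r k).1 (r k).2, Φ.toLinearMap ∘ₗ f,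
    isPseudoIso_of_isIsoAt hM htors fun p => (IsIsoAt.of_linearEquiv _ Φ).comp (hf p)⟩

theorem IsKrullDomain.isCharIdeal_charIdeal (hA : IsKrullDomain A) :
    IsCharIdeal A M (charIdeal A M) := by
  have h : ∃ I : Ideal A, IsCharIdeal A M I := by
    by_cases hM : Module.IsTorsion A M
    · obtain ⟨n, p, e, f, hf⟩ := hA.exists_isPseudoIso hM
      exact ⟨_, Or.inr ⟨hM, n, p, e, f, hf, rfl⟩⟩
    · exact ⟨⊥, Or.inl ⟨hM, rfl⟩⟩
  rw [charIdeal, dif_pos h]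
  exact h.choose_spec

theorem IsKrullDomain.charIdeal_eq_bot (hA : IsKrullDomain A) (hM : ¬ Module.IsTorsion A M) :
    charIdeal A M = ⊥ :=
  (hA.isCharIdeal_charIdeal.resolve_right fun h => hM h.1).2

theorem IsKrullDomain.mem_charIdeal_iff (hA : IsKrullDomain A) (hM : Module.IsTorsion A M) {x : A} :
    x ∈ charIdeal A M ↔ ∀ p : HeightOnePrime A, localLength p.1.asIdeal M ≤
      Ring.ord (Localization.AtPrime p.1.asIdeal) (algebraMap A _ x) := by
  obtain ⟨-, n, q, e, f, hf, hI⟩ := hA.isCharIdeal_charIdeal.resolve_left fun h => h.1 hM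
  rw [hI, divisorialHull, Ideal.mem_iInf]
  refine forall_congr' fun p => ?_
  have := hA.isDVR p
  have hf' := (IsIsoAt.of_linearEquiv p.1.asIdeal.primeCompl
    (DirectSum.linearEquivFunOnFintype A (Fin n) fun i => A ⧸ (q i).1.asIdeal ^ e i)).comp
    (hf.isIsoAt p)
  rw [hf'.localLength_eq, localLength_pi_quotient_le_ord_iff fun i => (q i).pow_ne_bot (e i),
    Ideal.mem_comap]

end Structure

section Divisibility

variable {A : Type*} [CommRing A] [IsDomain A] {d x : A}

theorem algebraMap_dvd_algebraMap_localizationAtPrime_iff (p : Ideal A) [p.IsPrime] :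
    algebraMap A (Localization.AtPrime p) d ∣ algebraMap A (Localization.AtPrime p) x ↔
      ∃ s ∉ p, d ∣ s * x := by
  constructor
  · rintro ⟨c, hc⟩
    obtain ⟨⟨y, s⟩, hs⟩ := IsLocalization.surj p.primeCompl c
    refine ⟨s, s.2, y, injective_algebraMap_localizationAtPrime p ?_⟩
    rw [map_mul, map_mul, hc, ← hs, mul_comm, mul_assoc]
  · rintro ⟨s, hs, h⟩
    have hu : IsUnit (algebraMap A (Localization.AtPrime p) s) :=
      IsLocalization.map_units (M := p.primeCompl) _ ⟨s, hs⟩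
    rw [← hu.dvd_mul_left, ← map_mul]
    exact map_dvd _ h

theorem IsKrullDomain.dvd_of_forall_algebraMap_dvd (hA : IsKrullDomain A) (hd : d ≠ 0)
    (h : ∀ p : HeightOnePrime A, algebraMap A (Localization.AtPrime p.1.asIdeal) d ∣
      algebraMap A (Localization.AtPrime p.1.asIdeal) x) : d ∣ x := by
  let K := FractionRing A
  have hdK : algebraMap A K d ≠ 0 := by simpa using hd
  obtain ⟨a, ha⟩ := hA.eq_inter (algebraMap A K x / algebraMap A K d) fun p => by
    obtain ⟨s, hs, y, hy⟩ := (algebraMap_dvd_algebraMap_localizationAtPrime_iff _).mp (h p)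
    refine ⟨y, s, hs, ?_⟩
    rw [div_mul_eq_mul_div, div_eq_iff hdK, ← map_mul, ← map_mul, mul_comm x, hy, mul_comm d]
  refine ⟨a, IsFractionRing.injective A K ?_⟩
  rw [map_mul, ha, mul_div_cancel₀ _ hdK]

theorem IsKrullDomain.exists_notMem_algebraMap_dvd (hA : IsKrullDomain A) (p : HeightOnePrime A)
    {P : Ideal A} [P.IsPrime] (hpP : ¬ p.1.asIdeal ≤ P) (hd : d ≠ 0) :
    ∃ c ∉ P, algebraMap A (Localization.AtPrime p.1.asIdeal) d ∣
      algebraMap A (Localization.AtPrime p.1.asIdeal) c := by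
  let R := Localization.AtPrime p.1.asIdeal
  have : IsDiscreteValuationRing R := hA.isDVR p
  obtain ⟨c, hcp, hcP⟩ := SetLike.not_le_iff_exists.mp hpP
  obtain ⟨ϖ, hϖ⟩ := IsDiscreteValuationRing.exists_irreducible R
  have hd0 : algebraMap A R d ≠ 0 := by
    simpa using (injective_algebraMap_localizationAtPrime p.1.asIdeal).ne hd
  obtain ⟨k, hk⟩ := IsDiscreteValuationRing.associated_pow_irreducible hd0 hϖ
  have hc : ϖ ∣ algebraMap A R c := by
    rw [← Ideal.mem_span_singleton, ← hϖ.maximalIdeal_eq]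
    exact (IsLocalization.AtPrime.to_map_mem_maximal_iff R p.1.asIdeal c).mpr hcp
  refine ⟨c ^ k, fun h => hcP (Ideal.IsPrime.mem_of_pow_mem ‹_› k h), ?_⟩
  rw [map_pow]
  exact hk.dvd.trans (pow_dvd_pow_of_dvd hc k)

theorem IsKrullDomain.algebraMap_dvd_of_forall_le (hA : IsKrullDomain A) (P : Ideal A) [P.IsPrime]
    (hd : d ≠ 0)
    (h : ∀ p : HeightOnePrime A, p.1.asIdeal ≤ P →
      algebraMap A (Localization.AtPrime p.1.asIdeal) d ∣
        algebraMap A (Localization.AtPrime p.1.asIdeal) x) :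
    algebraMap A (Localization.AtPrime P) d ∣ algebraMap A (Localization.AtPrime P) x := by
  have hc : ∀ p : HeightOnePrime A, ∃ c ∉ P,
      algebraMap A (Localization.AtPrime p.1.asIdeal) d ∣
        algebraMap A (Localization.AtPrime p.1.asIdeal) (c * x) := fun p => by
    by_cases hp : p.1.asIdeal ≤ P
    · exact ⟨1, P.ne_top_iff_one.mp Ideal.IsPrime.ne_top', by rw [one_mul]; exact h p hp⟩
    · obtain ⟨c, hcP, hc⟩ := hA.exists_notMem_algebraMap_dvd p hp hd
      exact ⟨c, hcP, by rw [map_mul]; exact hc.mul_right _⟩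
  choose c hcP hc using hc
  let F := (hA.finite_character d hd).toFinset
  rw [algebraMap_dvd_algebraMap_localizationAtPrime_iff]
  refine ⟨∏ p ∈ F, c p, fun hmem => ?_, hA.dvd_of_forall_algebraMap_dvd hd fun p => ?_⟩
  · obtain ⟨p, -, hp⟩ := Ideal.IsPrime.prod_mem_iff.mp hmem
    exact hcP p hp
  · by_cases hp : p ∈ F
    · exact (hc p).trans (map_dvd _ (mul_dvd_mul_right (Finset.dvd_prod_of_mem c hp) x))
    · have hdp : d ∉ p.1.asIdeal := fun h => hp (by simpa [F] using h)
      exact (IsLocalization.map_units (M := p.1.asIdeal.primeCompl) _ ⟨d, hdp⟩).dvd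

end Divisibility

section SquarePresentation

theorem exists_span_range_eq {R : Type*} [CommRing R] [IsDomain R] [IsPrincipalIdealRing R]
    {ι M : Type*} [Finite ι] [AddCommGroup M] [Module R M] (b : Module.Basis ι R M)
    (L : Submodule R M) : ∃ v : ι → M, Submodule.span R (Set.range v) = L := by
  obtain ⟨n, snf⟩ := L.smithNormalForm b
  have hspan : Submodule.span R (Set.range fun i => (snf.bN i : M)) = L := by
    have h := congrArg (Submodule.map L.subtype) snf.bN.span_eq
    rwa [Submodule.map_span, ← Set.range_comp, L.map_subtype_top] at h
  refine ⟨Function.extend snf.f (fun i => (snf.bN i : M)) 0, le_antisymm ?_ ?_⟩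
  · rw [Submodule.span_le]
    rintro _ ⟨j, rfl⟩
    by_cases hj : ∃ i, snf.f i = j
    · obtain ⟨i, rfl⟩ := hj
      simp [snf.f.injective.extend_apply]
    · simp [Function.extend_apply' _ _ _ hj]
  · refine hspan.symm.trans_le (Submodule.span_mono ?_)
    rintro _ ⟨i, rfl⟩
    exact ⟨snf.f i, snf.f.injective.extend_apply _ _ i⟩

variable {A : Type*} [CommRing A] {M N : Type*} [AddCommGroup M] [Module A M] [AddCommGroup N]
  [Module A N]

theorem exists_smul_mem_of_apply_mem_localized' {S : Submonoid A} (R : Type*) [CommRing R]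
    [Algebra A R] [IsLocalization S R] [Module R N] [IsScalarTower A R N] (l : M →ₗ[A] N)
    [IsLocalizedModule S l] {L : Submodule A M} {z : M} (hz : l z ∈ L.localized' R S l) :
    ∃ s : S, s • z ∈ L := by
  obtain ⟨m, hm, s, hs⟩ := hz
  rw [IsLocalizedModule.mk'_eq_iff, Submonoid.smul_def, ← map_smul] at hs
  obtain ⟨c, hc⟩ := IsLocalizedModule.exists_of_eq (S := S) hs
  exact ⟨c * s, by rw [mul_smul]; exact hc ▸ L.smul_mem (c : A) hm⟩

theorem exists_forall_exists_smul_mem_span_range {S : Submonoid A} {R : Type*} [CommRing R]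
    [IsDomain R] [IsPrincipalIdealRing R] [Algebra A R] [IsLocalization S R] [Module R N]
    [IsScalarTower A R N] (l : M →ₗ[A] N) [IsLocalizedModule S l] {ι : Type*} [Finite ι]
    (b : Module.Basis ι R N) (L : Submodule A M) :
    ∃ k : ι → M, (∀ i, k i ∈ L) ∧
      ∀ z ∈ L, ∃ s : S, s • z ∈ Submodule.span A (Set.range k) := by
  obtain ⟨v, hv⟩ := exists_span_range_eq b (L.localized' R S l)
  have hvL : ∀ i, v i ∈ L.localized' R S l := fun i => hv ▸ Submodule.subset_span ⟨i, rfl⟩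
  choose k hkL s hks using hvL
  have hle : L.localized' R S l ≤ (Submodule.span A (Set.range k)).localized' R S l := by
    rw [← hv, Submodule.span_le]
    rintro _ ⟨i, rfl⟩
    exact ⟨k i, Submodule.subset_span ⟨i, rfl⟩, s i, hks i⟩
  exact ⟨k, hkL, fun z hz => exists_smul_mem_of_apply_mem_localized' R l
    (hle ⟨z, hz, 1, IsLocalizedModule.mk'_one S l z⟩)⟩

theorem IsIsoAt.liftQ {S : Submonoid A} {g : M →ₗ[A] N} (hg : Function.Surjective g)
    {L : Submodule A M} (hL : L ≤ LinearMap.ker g)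
    (h : ∀ z ∈ LinearMap.ker g, ∃ s : S, s • z ∈ L) : IsIsoAt S (L.liftQ g hL) where
  exists_smul_eq_zero z hz := by
    obtain ⟨z, rfl⟩ := Submodule.Quotient.mk_surjective _ z
    obtain ⟨s, hs⟩ := h z hz
    exact ⟨s, (Submodule.Quotient.mk_eq_zero _).mpr hs⟩
  exists_map_eq_smul y := by
    obtain ⟨z, rfl⟩ := hg y
    exact ⟨1, Submodule.Quotient.mk z, by rw [one_smul]; rfl⟩

theorem isTorsion'_primeCompl_of_forall_smul_eq_smul [Module.Finite A M] {P : Ideal A}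
    [hP : P.IsPrime] {t : A} (ht : t ∈ P)
    (h : ∀ m : M, ∃ s : P.primeCompl, ∃ m' : M, s • m = t • m') :
    Module.IsTorsion' M P.primeCompl := by
  have hquot : (⟨P, hP⟩ : PrimeSpectrum A) ∉ Module.support A (QuotSMulTop t M) := by
    refine Module.notMem_support_iff'.mpr fun z => ?_
    obtain ⟨z, rfl⟩ := Submodule.Quotient.mk_surjective _ z
    obtain ⟨s, m', hs⟩ := h z
    have hmem := Submodule.smul_mem_pointwise_smul m' t (⊤ : Submodule A M) trivial
    rw [← hs] at hmem
    exact ⟨s, s.2, (Submodule.Quotient.mk_eq_zero _).mpr hmem⟩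
  have hsupp : (⟨P, hP⟩ : PrimeSpectrum A) ∉ Module.support A M := fun hmem =>
    hquot (Module.support_quotSMulTop (M := M) t ▸ ⟨hmem, by simpa using ht⟩)
  intro m
  obtain ⟨s, hs, hsm⟩ := Module.notMem_support_iff'.mp hsupp m
  exact ⟨⟨s, hs⟩, hsm⟩

-- As the `t`-torsion of `N` vanishes at `P`, a relation divisible by `t` is `t` times a relation
-- there, and Nakayama's lemma applies to the quotient of `ker g` by `L`.
theorem exists_smul_mem_of_exists_smul_sub_smul_mem [IsNoetherian A M] (g : M →ₗ[A] N) {P : Ideal A}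
    [P.IsPrime] {t : A} (ht : t ∈ P)
    (hN : ∃ s : P.primeCompl, ∀ y : N, t • y = 0 → s • y = 0)
    {L : Submodule A M} (hL : L ≤ LinearMap.ker g)
    (h : ∀ z ∈ LinearMap.ker g, ∃ s : P.primeCompl, ∃ v, s • z - t • v ∈ L) :
    ∀ z ∈ LinearMap.ker g, ∃ s : P.primeCompl, s • z ∈ L := by
  obtain ⟨s, hs⟩ := hN
  have htors : Module.IsTorsion' (LinearMap.ker g ⧸ L.submoduleOf (LinearMap.ker g))
      P.primeCompl := by
    refine isTorsion'_primeCompl_of_forall_smul_eq_smul ht fun z => ?_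
    obtain ⟨⟨z, hz⟩, rfl⟩ := Submodule.Quotient.mk_surjective _ z
    obtain ⟨r, v, hv⟩ := h z hz
    have htv : t • g v = 0 := by
      have hgz : g ((r : A) • z) = 0 := (LinearMap.ker g).smul_mem r hz
      have := hL hv
      rwa [LinearMap.mem_ker, map_sub, Submonoid.smul_def, hgz, zero_sub, neg_eq_zero,
        map_smul] at this
    have hsv : (s : A) • v ∈ LinearMap.ker g := by
      rw [LinearMap.mem_ker, map_smul]
      exact hs _ htv
    refine ⟨s * r, Submodule.Quotient.mk ⟨(s : A) • v, hsv⟩, ?_⟩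
    refine (Submodule.Quotient.eq _).mpr ?_
    have : s • r • z - t • (s : A) • v = (s : A) • (r • z - t • v) := by
      rw [smul_sub, smul_comm t]
      rfl
    change (s * r) • z - t • (s : A) • v ∈ L
    rw [mul_smul, this]
    exact L.smul_mem _ hv
  intro z hz
  obtain ⟨r, hr⟩ := @htors (Submodule.Quotient.mk ⟨z, hz⟩)
  exact ⟨r, (Submodule.Quotient.mk_eq_zero (L.submoduleOf _)).mp hr⟩

theorem det_ne_zero_of_isTorsion [IsDomain A] {ι : Type*} [Fintype ι] [DecidableEq ι]
    {D : Matrix ι ι A}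
    (h : Module.IsTorsion A ((ι → A) ⧸ Submodule.span A (Set.range D.row))) : D.det ≠ 0 := by
  intro hD
  obtain ⟨v, hv, hDv⟩ := Matrix.exists_mulVec_eq_zero_iff.mpr hD
  have hrows : Submodule.span A (Set.range D.row) ≤
      LinearMap.ker (Fintype.linearCombination A v) := by
    rw [Submodule.span_le]
    rintro _ ⟨i, rfl⟩
    exact congrFun hDv i
  refine hv (funext fun i => ?_)
  obtain ⟨a, ha⟩ := @h (Submodule.Quotient.mk (Pi.single i 1))
  have hai : (a : A) • Pi.single i (1 : A) ∈ LinearMap.ker (Fintype.linearCombination A v) :=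
    hrows ((Submodule.Quotient.mk_eq_zero _).mp ha)
  simpa using hai

section Reduction

variable {B : Type*} [CommRing B] {φ : A →+* B} {ι : Type*}

variable (φ ι) in
/-- The semilinear reduction map between free modules obtained by applying a ring homomorphism to
every coordinate; it carries relations of a module to relations of its reduction. -/
def coordMap : (ι → A) →ₛₗ[φ] (ι → B) where
  toFun x i := φ (x i)
  map_add' _ _ := funext fun _ => map_add φ _ _
  map_smul' _ _ := funext fun _ => map_mul φ _ _

theorem coordMap_surjective (hφ : Function.Surjective φ) : Function.Surjective (coordMap φ ι) :=
  hφ.comp_left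

theorem exists_eq_smul_of_coordMap_eq_zero {t : A} (hker : RingHom.ker φ = Ideal.span {t})
    {x : ι → A} (hx : coordMap φ ι x = 0) : ∃ y, x = t • y := by
  have hdvd : ∀ i, t ∣ x i := fun i => by
    rw [← Ideal.mem_span_singleton, ← hker]
    exact congrFun hx i
  choose y hy using hdvd
  exact ⟨y, funext hy⟩

theorem exists_smul_sub_smul_mem_span (hφ : Function.Surjective φ) {t : A}
    (hker : RingHom.ker φ = Ideal.span {t}) {κ : Type*} {D : κ → ι → A} {z : ι → A} {b : B}
    (h : b • coordMap φ ι z ∈ Submodule.span B (Set.range fun j => coordMap φ ι (D j))) :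
    ∃ r, φ r = b ∧ ∃ y, r • z - t • y ∈ Submodule.span A (Set.range D) := by
  have : RingHomSurjective φ := ⟨hφ⟩
  obtain ⟨r, rfl⟩ := hφ b
  rw [Set.range_comp' (coordMap φ ι) D, ← Submodule.map_span, ← map_smulₛₗ] at h
  obtain ⟨w, hw, hwz⟩ := h
  obtain ⟨y, hy⟩ := exists_eq_smul_of_coordMap_eq_zero hker (x := r • z - w) (by
    rw [map_sub, hwz, sub_self])
  exact ⟨r, rfl, y, by rwa [← hy, sub_sub_cancel]⟩

variable [Fintype ι] {N₁ : Type*} [AddCommGroup N₁] [Module B N₁]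

theorem linearCombination_coordMap (ν : N →ₛₗ[φ] N₁) (v : ι → N) (x : ι → A) :
    Fintype.linearCombination B (ν ∘ v) (coordMap φ ι x) = ν (Fintype.linearCombination A v x) := by
  simp [Fintype.linearCombination_apply, coordMap]

theorem exists_coordMap_eq_of_linearCombination_eq_zero (hφ : Function.Surjective φ) {t : A}
    (ht : φ t = 0) {ν : N →ₛₗ[φ] N₁} (hν : ∀ m, ν m = 0 → ∃ m', m = t • m') {v : ι → N}
    (hv : Function.Surjective (Fintype.linearCombination A v)) {y : ι → B}
    (hy : Fintype.linearCombination B (ν ∘ v) y = 0) :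
    ∃ x ∈ LinearMap.ker (Fintype.linearCombination A v), coordMap φ ι x = y := by
  obtain ⟨x, rfl⟩ := coordMap_surjective hφ y
  rw [linearCombination_coordMap] at hy
  obtain ⟨m, hm⟩ := hν _ hy
  obtain ⟨z, rfl⟩ := hv m
  refine ⟨x - t • z, ?_, ?_⟩
  · rw [LinearMap.mem_ker, map_sub, map_smul, hm, sub_self]
  · rw [map_sub, map_smulₛₗ, ht, zero_smul, sub_zero]

theorem exists_matrix_isIsoAt_quotient_span_row [IsNoetherianRing A] [Module.Finite A N]
    (hφ : Function.Surjective φ) {t : A} (hker : RingHom.ker φ = Ideal.span {t})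
    {ν : N →ₛₗ[φ] N₁} (hν : Function.Surjective ν) (hνker : ∀ m, ν m = 0 → ∃ m', m = t • m')
    (q : Ideal B) [q.IsPrime] [IsDomain (Localization.AtPrime q)]
    [IsPrincipalIdealRing (Localization.AtPrime q)]
    (hN : ∃ s : (q.comap φ).primeCompl, ∀ m : N, t • m = 0 → s • m = 0) :
    ∃ (n : ℕ) (D : Matrix (Fin n) (Fin n) A)
      (f : ((Fin n → A) ⧸ Submodule.span A (Set.range D.row)) →ₗ[A] N)
      (f₁ : ((Fin n → B) ⧸ Submodule.span B (Set.range (D.map φ).row)) →ₗ[B] N₁),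
      IsIsoAt (q.comap φ).primeCompl f ∧ IsIsoAt q.primeCompl f₁ := by
  have ht : φ t = 0 := by
    rw [← RingHom.mem_ker, hker]
    exact Ideal.mem_span_singleton_self t
  obtain ⟨n, v, hv⟩ := Module.Finite.exists_fin (R := A) (M := N)
  have hg : Function.Surjective (Fintype.linearCombination A v) := by
    rw [← LinearMap.range_eq_top, Fintype.range_linearCombination, hv]
  have hg₁ : Function.Surjective (Fintype.linearCombination B (ν ∘ v)) := fun y => by
    obtain ⟨m, rfl⟩ := hν y
    obtain ⟨x, rfl⟩ := hg m
    exact ⟨coordMap φ _ x, linearCombination_coordMap ν v x⟩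
  let R := Localization.AtPrime q
  obtain ⟨k, hk, hk_span⟩ := exists_forall_exists_smul_mem_span_range (S := q.primeCompl)
    (LinearMap.pi fun i => Algebra.linearMap B R ∘ₗ LinearMap.proj i) (Pi.basisFun R (Fin n))
    (LinearMap.ker (Fintype.linearCombination B (ν ∘ v)))
  choose D hD hDk using fun j =>
    exists_coordMap_eq_of_linearCombination_eq_zero hφ ht hνker hg (hk j)
  obtain rfl : (fun j => coordMap φ _ (D j)) = k := funext hDk
  have hL : Submodule.span A (Set.range D) ≤ LinearMap.ker (Fintype.linearCombination A v) := by
    rw [Submodule.span_le]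
    exact Set.range_subset_iff.mpr hD
  have hL₁ : Submodule.span B (Set.range fun j => coordMap φ _ (D j)) ≤
      LinearMap.ker (Fintype.linearCombination B (ν ∘ v)) := by
    rw [Submodule.span_le]
    exact Set.range_subset_iff.mpr hk
  refine ⟨n, D, _, _, IsIsoAt.liftQ hg hL ?_, IsIsoAt.liftQ hg₁ hL₁ hk_span⟩
  refine exists_smul_mem_of_exists_smul_sub_smul_mem _ (by simp [ht]) hN hL fun z hz => ?_
  have hz₁ : coordMap φ _ z ∈ LinearMap.ker (Fintype.linearCombination B (ν ∘ v)) := by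
    rw [LinearMap.mem_ker, linearCombination_coordMap, LinearMap.mem_ker.mp hz, map_zero]
  obtain ⟨s, hs⟩ := hk_span _ hz₁
  obtain ⟨r, hr, w, hw⟩ := exists_smul_sub_smul_mem_span hφ hker hs
  exact ⟨⟨r, fun h => s.2 (hr ▸ h)⟩, w, hw⟩

end Reduction

end SquarePresentation

section Descent

theorem exists_notMem_span_singleton_forall_smul_eq_zero {A N : Type*} [CommRing A] [IsDomain A]
    [IsNoetherianRing A] [AddCommGroup N] [Module A N] [Module.Finite A N]
    (hN : Module.IsTorsion A N) {t : A} (ht : (Ideal.span {t}).IsPrime)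
    (h : ∃ s ∉ Ideal.span {t}, ∀ m : N, t • m = 0 → s • m = 0) :
    ∃ a ∉ Ideal.span {t}, ∀ m : N, a • m = 0 := by
  obtain ⟨s, hs, hsN⟩ := h
  have hpow : ∀ j (m : N), t ^ j • m = 0 → s ^ j • m = 0 := fun j => by
    induction j with
    | zero => simp
    | succ j ih =>
      intro m hm
      rw [pow_succ', mul_smul] at hm
      rw [pow_succ, mul_smul]
      exact ih _ (by rw [smul_comm]; exact hsN _ hm)
  obtain ⟨a, ha, haN⟩ := exists_ne_zero_forall_smul_eq_zero hN
  have htu : ¬ IsUnit t := fun h => ht.ne_top (Ideal.span_singleton_eq_top.mpr h)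
  obtain ⟨k, b, hb, rfl⟩ := WfDvdMonoid.max_power_factor' ha htu
  rw [← Ideal.mem_span_singleton] at hb
  refine ⟨s ^ k * b, fun h => ?_, fun m => ?_⟩
  · exact (ht.mem_or_mem h).elim (fun h => hs (ht.mem_of_pow_mem k h)) hb
  · rw [mul_smul]
    exact hpow k _ (by rw [smul_smul]; exact haN m)

variable {A : Type u} {B : Type v} [CommRing A] [CommRing B] {φ : A →+* B} {t : A} {N N₁ : Type*}
  [AddCommGroup N] [Module A N] [AddCommGroup N₁] [Module B N₁] {ν : N →ₛₗ[φ] N₁}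

theorem IsPseudoNullTorsion.exists_notMem_comap (hφ : Function.Surjective φ)
    (hker : RingHom.ker φ = Ideal.span {t}) (hN : IsPseudoNullTorsion φ hφ N) (q : Ideal B)
    (hq : q.height ≤ 1) : ∃ s ∉ q.comap φ, ∀ m : N, t • m = 0 → s • m = 0 := by
  let := torsionDescent φ hφ N
  obtain ⟨b, hb, hbN⟩ := IsPseudoNull.exists_notMem_forall_smul_eq_zero hN q hq
  obtain ⟨s, rfl⟩ := hφ b
  refine ⟨s, hb, fun m hm => ?_⟩
  have hmem : m ∈ Submodule.torsionBySet A N (RingHom.ker φ) := by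
    rw [hker]
    exact (Submodule.torsionBySet_span_singleton_eq t).ge hm
  have h := hbN ⟨m, hmem⟩
  rw [torsionDescent_smul φ hφ N] at h
  exact congrArg Subtype.val h

variable [IsDomain A] [IsNoetherianRing A] [Module.Finite A N] [IsDomain B]

theorem isTorsion_of_surjective_of_ker_eq_span (hker : RingHom.ker φ = Ideal.span {t})
    (hν : Function.Surjective ν) (hN : Module.IsTorsion A N)
    (h : ∃ s ∉ RingHom.ker φ, ∀ m : N, t • m = 0 → s • m = 0) : Module.IsTorsion B N₁ := by
  rw [hker] at h
  obtain ⟨a, ha, haN⟩ := exists_notMem_span_singleton_forall_smul_eq_zero hN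
    (hker ▸ RingHom.ker_isPrime φ) h
  rw [← hker, RingHom.mem_ker] at ha
  intro m
  obtain ⟨m, rfl⟩ := hν m
  refine ⟨⟨φ a, mem_nonZeroDivisors_of_ne_zero ha⟩, ?_⟩
  rw [Submonoid.mk_smul, ← map_smulₛₗ, haN, map_zero]

theorem localLength_le_ord_of_mem_charIdeal (hA : IsKrullDomain A) (hφ : Function.Surjective φ)
    (hker : RingHom.ker φ = Ideal.span {t}) (hν : Function.Surjective ν)
    (hνker : ∀ m, ν m = 0 → ∃ m', m = t • m') (hN : Module.IsTorsion A N)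
    (hN₁ : Module.IsTorsion B N₁) (q : Ideal B) [q.IsPrime]
    [IsDiscreteValuationRing (Localization.AtPrime q)]
    (h : ∃ s ∉ q.comap φ, ∀ m : N, t • m = 0 → s • m = 0) {x : A} (hx : x ∈ charIdeal A N) :
    localLength q N₁ ≤
      Ring.ord (Localization.AtPrime q) (algebraMap B (Localization.AtPrime q) (φ x)) := by
  obtain ⟨s, hs, hsN⟩ := h
  obtain ⟨n, D, f, f₁, hf, hf₁⟩ :=
    exists_matrix_isIsoAt_quotient_span_row hφ hker hν hνker q ⟨⟨s, hs⟩, hsN⟩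
  have hmapdet : (D.map φ).det = φ D.det := (RingHom.map_det φ D).symm
  have hdet₁ : (D.map φ).det ≠ 0 :=
    det_ne_zero_of_isTorsion (hf₁.isTorsion q.primeCompl_le_nonZeroDivisors hN₁)
  have hdet : D.det ≠ 0 := fun h => hdet₁ (by rw [hmapdet, h, map_zero])
  have hdvd : algebraMap A (Localization.AtPrime (q.comap φ)) D.det ∣
      algebraMap A (Localization.AtPrime (q.comap φ)) x :=
    hA.algebraMap_dvd_of_forall_le _ hdet fun p hp => by
      have := hA.isDVR p
      have hfp : IsIsoAt p.1.asIdeal.primeCompl f := hf.mono fun a ha h => ha (hp h)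
      rw [← ord_le_ord_iff_dvd, ← localLength_quotient_span_row hdet, hfp.localLength_eq]
      exact (hA.mem_charIdeal_iff hN).mp hx p
  obtain ⟨c, hc, hcx⟩ := (algebraMap_dvd_algebraMap_localizationAtPrime_iff _).mp hdvd
  rw [← hf₁.localLength_eq, localLength_quotient_span_row hdet₁, ord_le_ord_iff_dvd,
    algebraMap_dvd_algebraMap_localizationAtPrime_iff, hmapdet]
  exact ⟨φ c, hc, by rw [← map_mul]; exact map_dvd φ hcx⟩

variable [IsNoetherianRing B]

theorem map_mem_charIdeal (hA : IsKrullDomain A) (hB : IsKrullDomain B)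
    (hφ : Function.Surjective φ) (hker : RingHom.ker φ = Ideal.span {t})
    (hν : Function.Surjective ν) (hνker : ∀ m, ν m = 0 → ∃ m', m = t • m')
    (h : ∀ q : Ideal B, q.height ≤ 1 → ∃ s ∉ q.comap φ, ∀ m : N, t • m = 0 → s • m = 0)
    {x : A} (hx : x ∈ charIdeal A N) : φ x ∈ charIdeal B N₁ := by
  by_cases hN : Module.IsTorsion A N
  · have hN₁ : Module.IsTorsion B N₁ :=
      isTorsion_of_surjective_of_ker_eq_span hker hν hN (h ⊥ (by simp))
    have : RingHomSurjective φ := ⟨hφ⟩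
    have : Module.Finite B N₁ := Module.Finite.of_surjective ν hν
    refine (hB.mem_charIdeal_iff hN₁).mpr fun q => ?_
    have := hB.isDVR q
    exact localLength_le_ord_of_mem_charIdeal hA hφ hker hν hνker hN hN₁ _ (h _ q.2.le) hx
  · rw [hA.charIdeal_eq_bot hN, Ideal.mem_bot] at hx
    rw [hx, map_zero]
    exact zero_mem _

theorem map_mem_charIdealQuotient (hA : IsKrullDomain A) (hB : IsKrullDomain B)
    (hφ : Function.Surjective φ) (hker : RingHom.ker φ = Ideal.span {t})
    (hN : IsPseudoNullTorsion φ hφ N) {x : A} (hx : x ∈ charIdeal A N) :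
    φ x ∈ charIdealQuotient φ hφ N := by
  let := quotientDescent φ hφ N
  let ν : N →ₛₗ[φ] N ⧸ RingHom.ker φ • (⊤ : Submodule A N) :=
    { toFun := Submodule.Quotient.mk
      map_add' := fun _ _ => rfl
      map_smul' := fun r m => (quotientDescent_smul φ hφ N r (Submodule.Quotient.mk m)).symm }
  have hνker : ∀ m, ν m = 0 → ∃ m', m = t • m' := fun m hm => by
    have hmem : m ∈ RingHom.ker φ • (⊤ : Submodule A N) := (Submodule.Quotient.mk_eq_zero _).mp hm
    rw [hker, Submodule.ideal_span_singleton_smul] at hmem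
    obtain ⟨m', -, hm'⟩ := hmem
    exact ⟨m', hm'.symm⟩
  exact map_mem_charIdeal hA hB hφ hker (ν := ν) (Submodule.Quotient.mk_surjective _) hνker
    (hN.exists_notMem_comap hφ hker) hx

end Descent

section InverseLimit

variable {X : ℕ → Type u} {f : ∀ d, X (d + 1) → X d} {L : Type v} {p : ∀ d, L → X d}

theorem IsInverseLimit.existsUnique_forall_ge (h : IsInverseLimit f p) (d₀ : ℕ)
    {x : ∀ d, d₀ ≤ d → X d} (hx : ∀ d hd, f d (x (d + 1) (Nat.le_succ_of_le hd)) = x d hd) :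
    ∃! l, ∀ d hd, p d l = x d hd := by
  induction d₀ with
  | zero => simpa using h.2 (fun d => x d d.zero_le) fun d => hx d d.zero_le
  | succ d₀ ih =>
    refine (existsUnique_congr fun l => ⟨fun hl d hd => ?_, fun hl d hd => ?_⟩).mp
      (ih (x := fun d hd => f d (x (d + 1) (Nat.succ_le_succ hd)))
        fun d hd => congrArg (f d) (hx (d + 1) (Nat.succ_le_succ hd)))
    · exact (hl d (Nat.le_of_succ_le hd)).trans (hx d hd)
    · exact (h.1 d l).symm.trans (congrArg (f d) (hl (d + 1) (Nat.succ_le_succ hd)))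

theorem IsInverseLimit.tail (h : IsInverseLimit f p) (d₀ : ℕ) :
    IsInverseLimit (X := fun k => X (d₀ + k)) (fun k => f (d₀ + k)) fun k => p (d₀ + k) := by
  refine ⟨fun k => h.1 (d₀ + k), fun x hx => ?_⟩
  obtain ⟨y, hy⟩ : ∃ y : ∀ d, d₀ ≤ d → X d, ∀ k hk, y (d₀ + k) hk = x k :=
    ⟨fun d hd => Nat.add_sub_of_le hd ▸ x (d - d₀), fun k hk => by grind⟩
  refine (existsUnique_congr fun l => ⟨fun hl k => ?_, fun hl d hd => ?_⟩).mp
    (h.existsUnique_forall_ge d₀ (x := y) fun d hd => ?_)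
  · exact (hl _ (Nat.le_add_right d₀ k)).trans (hy k _)
  · obtain ⟨k, rfl⟩ := Nat.exists_eq_add_of_le hd
    exact (hl k).trans (hy k hd).symm
  · obtain ⟨k, rfl⟩ := Nat.exists_eq_add_of_le hd
    exact (congrArg _ (hy (k + 1) _)).trans ((hx k).trans (hy k hd).symm)

theorem IsInverseLimit.restrict (h : IsInverseLimit f p) {s : ∀ d, Set (X d)} {T : Set L}
    (hs : ∀ d, Set.MapsTo (f d) (s (d + 1)) (s d)) (hT : ∀ l, l ∈ T ↔ ∀ d, p d l ∈ s d) :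
    IsInverseLimit (X := fun d => s d) (L := T) (fun d => (hs d).restrict)
      (fun d l => ⟨p d l, (hT l).mp l.2 d⟩) := by
  refine ⟨fun d l => Subtype.ext (h.1 d l), fun x hx => ?_⟩
  obtain ⟨l, hl, huniq⟩ := h.2 (fun d => x d) fun d => congrArg Subtype.val (hx d)
  exact ⟨⟨l, (hT l).mpr fun d => hl d ▸ (x d).2⟩, fun d => Subtype.ext (hl d),
    fun l' hl' => Subtype.ext (huniq l' fun d => congrArg Subtype.val (hl' d))⟩

theorem isInverseLimit_id (L : Type u) :
    IsInverseLimit (X := fun _ => L) (fun _ => id) fun _ => (id : L → L) := by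
  refine ⟨fun _ _ => rfl, fun x hx => ⟨x 0, fun d => ?_, fun l hl => hl 0⟩⟩
  induction d with
  | zero => rfl
  | succ d ih => exact ih.trans (hx d).symm

end InverseLimit

theorem theorem2p10_general {Λ : ℕ → Type u} [∀ d, CommRing (Λ d)] [∀ d, IsDomain (Λ d)]
    [∀ d, IsNoetherianRing (Λ d)] (hKrull : ∀ d, IsKrullDomain (Λ d))
    (φ : ∀ d, Λ (d + 1) →+* Λ d) (hφ : ∀ d, Function.Surjective (φ d))
    (t : ∀ d, Λ (d + 1)) (hker : ∀ d, RingHom.ker (φ d) = Ideal.span {t d})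
    {Λlim : Type*} [CommRing Λlim] (π : ∀ d, Λlim →+* Λ d)
    (hΛlim : IsInverseLimit (fun d => φ d) (fun d => π d))
    {M : ℕ → Type v} [∀ d, AddCommGroup (M d)] [∀ d, Module (Λ d) (M d)]
    [∀ d, Module.Finite (Λ d) (M d)] (d₀ : ℕ)
    (h₁ : ∀ d ≥ d₀, IsPseudoNullTorsion (φ d) (hφ d) (M (d + 1)))
    (h₂ : ∀ d ≥ d₀, charIdealQuotient (φ d) (hφ d) (M (d + 1)) ≤ charIdeal (Λ d) (M d)) :
    ∃ hφCh : ∀ d ≥ d₀, Set.MapsTo (φ d)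
        (charIdeal (Λ (d + 1)) (M (d + 1))) (charIdeal (Λ d) (M d)),
    ∃ hincl : ∀ d ≥ d₀, charPreimage π M (d + 1) ≤ charPreimage π M d,
    IsInverseLimit
        (X := fun k => charPreimage π M (d₀ + k)) (L := proCharIdeal π M d₀)
        (fun k => Submodule.inclusion (hincl (d₀ + k) (Nat.le_add_right d₀ k)))
        (fun k => Submodule.inclusion (proCharIdeal_le π M d₀ k)) ∧
    IsInverseLimit
        (X := fun k => charIdeal (Λ (d₀ + k)) (M (d₀ + k))) (L := proCharIdeal π M d₀)
        (fun k => (hφCh (d₀ + k) (Nat.le_add_right d₀ k)).restrict)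
        (fun k x => ⟨π (d₀ + k) x, proCharIdeal_le π M d₀ k x.2⟩) ∧
    ∀ d₁ ≥ d₀, proCharIdeal π M d₁ = proCharIdeal π M d₀ := by
  have hφCh : ∀ d ≥ d₀, Set.MapsTo (φ d)
      (charIdeal (Λ (d + 1)) (M (d + 1))) (charIdeal (Λ d) (M d)) := fun d hd x hx =>
    h₂ d hd (map_mem_charIdealQuotient (hKrull (d + 1)) (hKrull d) (hφ d) (hker d) (h₁ d hd) hx)
  have hincl : ∀ d ≥ d₀, charPreimage π M (d + 1) ≤ charPreimage π M d := fun d hd x hx => by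
    have := hφCh d hd hx
    rwa [show φ d (π (d + 1) x) = π d x from hΛlim.1 d x] at this
  have hanti : Antitone fun k => charPreimage π M (d₀ + k) :=
    antitone_nat_of_succ_le fun k => hincl (d₀ + k) (Nat.le_add_right d₀ k)
  have hmem : ∀ x, x ∈ proCharIdeal π M d₀ ↔ ∀ k, x ∈ charPreimage π M (d₀ + k) :=
    fun _ => Submodule.mem_iInf _
  refine ⟨hφCh, hincl, (isInverseLimit_id Λlim).restrict
    (s := fun k => charPreimage π M (d₀ + k)) (fun k => hanti k.le_succ) hmem,
    (hΛlim.tail d₀).restrict _ hmem, fun d₁ hd₁ => ?_⟩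
  obtain ⟨j, rfl⟩ := Nat.exists_eq_add_of_le hd₁
  rw [proCharIdeal, proCharIdeal, ← hanti.iInf_nat_add j]
  simp only [add_assoc, add_comm j]

theorem theorem2p10 {Λ : ℕ → Type u} [∀ d, CommRing (Λ d)] [∀ d, IsDomain (Λ d)]
    [∀ d, IsNoetherianRing (Λ d)] (hKrull : ∀ d, IsKrullDomain (Λ d))
    (φ : ∀ d, Λ (d + 1) →+* Λ d) (hφ : ∀ d, Function.Surjective (φ d))
    (t : ∀ d, Λ (d + 1)) (hker : ∀ d, RingHom.ker (φ d) = Ideal.span {t d})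
    (hprime : ∀ d, (Ideal.span {t d}).IsPrime) (hheight : ∀ d, (Ideal.span {t d}).height = 1)
    (hcomplete : ∀ d, IsAdicComplete (Ideal.span {t d}) (Λ (d + 1)))
    {Λlim : Type*} [CommRing Λlim] (π : ∀ d, Λlim →+* Λ d)
    (hΛlim : IsInverseLimit (fun d => φ d) (fun d => π d))
    {M : ℕ → Type v} [∀ d, AddCommGroup (M d)] [∀ d, Module (Λ d) (M d)]
    [∀ d, Module.Finite (Λ d) (M d)] (ψ : ∀ d, M (d + 1) →ₛₗ[φ d] M d)
    {Mlim : Type*} [AddCommGroup Mlim] [Module Λlim Mlim] [Module.Finite Λlim Mlim]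
    (ρ : ∀ d, Mlim →ₛₗ[π d] M d) (hMlim : IsInverseLimit (fun d => ψ d) (fun d => ρ d))
    (d₀ : ℕ)
    (h₁ : ∀ d ≥ d₀, IsPseudoNullTorsion (φ d) (hφ d) (M (d + 1)))
    (h₂ : ∀ d ≥ d₀, charIdealQuotient (φ d) (hφ d) (M (d + 1)) ≤ charIdeal (Λ d) (M d)) :
    -- the characteristic ideals form an inverse system under the transition maps of the rings
    ∃ hφCh : ∀ d ≥ d₀, Set.MapsTo (φ d)
        (charIdeal (Λ (d + 1)) (M (d + 1))) (charIdeal (Λ d) (M d)),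
    -- their preimages in the limit ring form an inverse system under inclusion
    ∃ hincl : ∀ d ≥ d₀, charPreimage π M (d + 1) ≤ charPreimage π M d,
    -- the pro-characteristic ideal is the inverse limit of the preimages
    IsInverseLimit
        (X := fun k => charPreimage π M (d₀ + k)) (L := proCharIdeal π M d₀)
        (fun k => Submodule.inclusion (hincl (d₀ + k) (Nat.le_add_right d₀ k)))
        (fun k => Submodule.inclusion (proCharIdeal_le π M d₀ k)) ∧
    -- it is also the inverse limit of the characteristic ideals themselves
    IsInverseLimit
        (X := fun k => charIdeal (Λ (d₀ + k)) (M (d₀ + k))) (L := proCharIdeal π M d₀)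
        (fun k => (hφCh (d₀ + k) (Nat.le_add_right d₀ k)).restrict)
        (fun k x => ⟨π (d₀ + k) x, proCharIdeal_le π M d₀ k x.2⟩) ∧
    -- it does not depend on the level at which the system is started
    ∀ d₁ ≥ d₀, proCharIdeal π M d₁ = proCharIdeal π M d₀ :=
  theorem2p10_general hKrull φ hφ t hker π hΛlim d₀ h₁ h₂
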